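/- Let $X$ be a complex Banach space (in particular, an infinite-dimensional one) and let $T\in L(X)$ be a bounded linear operator. For a bounded operator $S$ on a Banach space, with kernel $\mathcal N(S)$ and range $\mathcal R(S)$, say that $S$ is - *upper semi-Fredholm* if $\mathcal R(S)$ is closed and $\dim\mathcal N(S)<\infty$; *lower semi-Fredholm* if $\operatorname{codim}\mathcal R(S)<\infty$; *semi-Fredholm* if it is upper or lower semi-Fredholm; - *semi-regular* if $\mathcal R(S)$ is closed and $\mathcal N(S)\subset\bigcap_{n\in\mathbb N}\mathcal R(S^n)$; - *quasi-nilpotent* if its spectrum satisfies $\sigma(S)\subset\{0\}$ (so the operator on the zero space is quasi-nilpotent). Write $(M,N)\in \mathrm{Red}(T)$ if $M$ and $N$ are closed $T$-invariant subspaces of $X$ with $X=M\oplus N$ (possibly $M=\{0\}$ or $N=\{0\}$), and let $T_M:M\to M$ and $T_N:N\to N$ denote the restrictions of $T$. The operator $T$ is *upper* (resp. *lower*) *pseudo semi-B-Fredholm* if there is $(M,N)\in\mathrm{Red}(T)$ such that $T_M$ is upper (resp. lower) semi-Fredholm and $T_N$ is quasi-nilpotent; it is *pseudo semi-B-Fredholm*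 if it is upper or lower pseudo semi-B-Fredholm. It is *pseudo-Fredholm* if there is $(M,N)\in\mathrm{Red}(T)$ such that $T_M$ is semi-regular and $T_N$ is quasi-nilpotent. Then $T$ is pseudo semi-B-Fredholm if and only if there is $(M,N)\in\mathrm{Red}(T)$ such that $T_M$ is both semi-Fredholm and semi-regular and $T_N$ is quasi-nilpotent (that is, $T=T_1\oplus T_2$ with $T_1$ semi-Fredholm and semi-regular and $T_2$ quasi-nilpotent). In particular, every pseudo semi-B-Fredholm operator is pseudo-Fredholm. -/

import Mathlib

namespace PseudoFredholm

section Operators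

variable {Y : Type*} [NormedAddCommGroup Y] [NormedSpace ℂ Y]

/-- `T` is upper semi-Fredholm: closed range and finite-dimensional kernel. -/
def IsUpperSemiFredholm (T : Y →L[ℂ] Y) : Prop :=
  IsClosed (T.range : Set Y) ∧ FiniteDimensional ℂ T.ker

/-- `T` is lower semi-Fredholm: the range has finite codimension. -/
def IsLowerSemiFredholm (T : Y →L[ℂ] Y) : Prop :=
  FiniteDimensional ℂ (Y ⧸ T.range)

/-- `T` is semi-Fredholm: upper or lower semi-Fredholm. -/
def IsSemiFredholm (T : Y →L[ℂ] Y) : Prop :=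
  IsUpperSemiFredholm T ∨ IsLowerSemiFredholm T

/-- `T` is semi-regular: closed range, and the kernel lies in the range of every power. -/
def IsSemiRegular (T : Y →L[ℂ] Y) : Prop :=
  IsClosed (T.range : Set Y) ∧ T.ker ≤ ⨅ n : ℕ, (T ^ n).range

/-- `T` is quasi-nilpotent: the spectrum has no point other than `0`. (On the zero space, where the
spectrum is empty, the only operator is quasi-nilpotent.) -/
def IsQuasiNilpotent (T : Y →L[ℂ] Y) : Prop :=
  spectrum ℂ T ⊆ {0}

/-- `(M, N) ∈ Red(T)`: `M` and `N` are closed `T`-invariant subspaces whose direct sum is the whole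
space. -/
structure Reduces (T : Y →L[ℂ] Y) (M N : Submodule ℂ Y) : Prop where
  isClosed_left : IsClosed (M : Set Y)
  isClosed_right : IsClosed (N : Set Y)
  mapsTo_left : Set.MapsTo T M M
  mapsTo_right : Set.MapsTo T N N
  isCompl : IsCompl M N

/-- `T` is upper pseudo semi-B-Fredholm. -/
def IsUpperPseudoSemiBFredholm (T : Y →L[ℂ] Y) : Prop :=
  ∃ (M N : Submodule ℂ Y) (h : Reduces T M N),
    IsUpperSemiFredholm (T.restrict h.mapsTo_left) ∧
      IsQuasiNilpotent (T.restrict h.mapsTo_right)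

/-- `T` is lower pseudo semi-B-Fredholm. -/
def IsLowerPseudoSemiBFredholm (T : Y →L[ℂ] Y) : Prop :=
  ∃ (M N : Submodule ℂ Y) (h : Reduces T M N),
    IsLowerSemiFredholm (T.restrict h.mapsTo_left) ∧
      IsQuasiNilpotent (T.restrict h.mapsTo_right)

/-- `T` is pseudo semi-B-Fredholm. -/
def IsPseudoSemiBFredholm (T : Y →L[ℂ] Y) : Prop :=
  IsUpperPseudoSemiBFredholm T ∨ IsLowerPseudoSemiBFredholm T

/-- `T` is pseudo-Fredholm: it has a generalized Kato decomposition. -/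
def IsPseudoFredholm (T : Y →L[ℂ] Y) : Prop :=
  ∃ (M N : Submodule ℂ Y) (h : Reduces T M N),
    IsSemiRegular (T.restrict h.mapsTo_left) ∧
      IsQuasiNilpotent (T.restrict h.mapsTo_right)

end Operators

end PseudoFredholm

/-!
Let `S` be semi-Fredholm, so that all its powers have closed range. If `S` is not semi-regular, some
`y` satisfies `S ^ (n + 1) y = 0` and `S ^ n y ∉ range (S ^ (n + 1))`, and by Hahn–Banach a bounded
functional `φ` vanishes on `range (S ^ (n + 1))` but not at `S ^ n y`. The matrix
`φ (S ^ (i + j) y)`, `i, j ≤ n`, is antitriangular with constant nonzero antidiagonal, so the span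
of the Jordan chain of `y` is a nonzero `S`-invariant nilpotent summand, complementary to the common
kernel of the functionals `φ ∘ S ^ i`. Passing to the complement strictly lowers the smaller of
nullity and deficiency, so the splitting ends at a semi-regular summand, which inherits
semi-Fredholmness. For a pseudo semi-B-Fredholm operator, the nilpotent summand split off the
semi-Fredholm part is absorbed by the quasi-nilpotent one.
-/

namespace PseudoFredholm

open LinearMap Module

section JordanChain

theorem exists_pow_succ_apply_eq_zero_of_not_ker_le {R M : Type*} [Semiring R] [AddCommMonoid M]
    [Module R M] {f : End R M} (hf : ¬ ker f ≤ ⨅ n : ℕ, range (f ^ n)) :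
    ∃ n y, (f ^ (n + 1)) y = 0 ∧ (f ^ n) y ∉ range (f ^ (n + 1)) := by
  classical
  simp only [SetLike.not_le_iff_exists, Submodule.mem_iInf, not_forall] at hf
  obtain ⟨x, hx, hm⟩ := hf
  obtain ⟨n, hn⟩ : ∃ n, Nat.find hm = n + 1 :=
    Nat.exists_eq_succ_of_ne_zero (by simp [Nat.find_eq_zero])
  obtain ⟨y, rfl⟩ : x ∈ range (f ^ n) := not_not.1 (Nat.find_min hm (by omega))
  refine ⟨n, y, ?_, hn ▸ Nat.find_spec hm⟩
  rwa [pow_succ', End.mul_apply]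

theorem isCompl_ker_range_of_bijective_comp {R M N P : Type*} [Ring R] [AddCommGroup M]
    [AddCommGroup N] [AddCommGroup P] [Module R M] [Module R N] [Module R P] {g : N →ₗ[R] P}
    {h : M →ₗ[R] N} (hgh : Function.Bijective (g ∘ₗ h)) : IsCompl (ker g) (range h) := by
  refine ⟨Submodule.disjoint_def.2 ?_, Submodule.codisjoint_iff_exists_add_eq.2 fun z => ?_⟩
  · rintro _ hm ⟨x, rfl⟩
    rw [(injective_iff_map_eq_zero _).1 hgh.1 x hm, map_zero]
  · obtain ⟨x, hx⟩ := hgh.2 (g z)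
    exact ⟨z - h x, h x, by simp_all, ⟨x, rfl⟩, sub_add_cancel _ _⟩

variable {R M : Type*} [CommSemiring R] [AddCommMonoid M] [Module R M]

/-- The smallest `f`-invariant submodule containing `y`. It is spanned by a Jordan chain when a
power of `f` annihilates `y`. -/
def orbitSpan (f : End R M) (y : M) : Submodule R M :=
  Submodule.span R (Set.range fun i : ℕ => (f ^ i) y)

/-- The largest `f`-invariant submodule on which the functional `φ` vanishes, dual to
`orbitSpan`. -/
def orbitKer (f : End R M) (φ : Dual R M) : Submodule R M :=
  ⨅ i : ℕ, ker (φ ∘ₗ f ^ i)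

variable {f : End R M} {y : M} {φ : Dual R M} {n : ℕ}

theorem mem_orbitSpan_self : y ∈ orbitSpan f y :=
  Submodule.subset_span ⟨0, rfl⟩

theorem mapsTo_orbitSpan : Set.MapsTo f (orbitSpan f y) (orbitSpan f y) := by
  suffices orbitSpan f y ≤ (orbitSpan f y).comap f from this
  refine Submodule.span_le.2 ?_
  rintro _ ⟨i, rfl⟩
  exact Submodule.subset_span ⟨i + 1, by simp only [pow_succ', End.mul_apply]⟩

theorem mem_orbitKer {z : M} : z ∈ orbitKer f φ ↔ ∀ i, φ ((f ^ i) z) = 0 := by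
  simp [orbitKer]

theorem mapsTo_orbitKer : Set.MapsTo f (orbitKer f φ) (orbitKer f φ) := fun z hz =>
  mem_orbitKer.2 fun i => by
    simpa only [pow_succ, End.mul_apply] using mem_orbitKer.1 hz (i + 1)

theorem pow_apply_eq_zero_of_mem_orbitSpan (hy : (f ^ n) y = 0) {z : M} (hz : z ∈ orbitSpan f y) :
    (f ^ n) z = 0 := by
  suffices orbitSpan f y ≤ ker (f ^ n) from this hz
  refine Submodule.span_le.2 ?_
  rintro _ ⟨i, rfl⟩
  rw [SetLike.mem_coe, mem_ker, ← End.mul_apply, ← pow_add, add_comm, pow_add, End.mul_apply, hy,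
    map_zero]

theorem orbitSpan_eq_range_linearCombination (hy : (f ^ n) y = 0) :
    orbitSpan f y = range (Fintype.linearCombination R fun j : Fin n => (f ^ (j : ℕ)) y) := by
  rw [Fintype.range_linearCombination]
  refine le_antisymm (Submodule.span_le.2 ?_) (Submodule.span_mono ?_)
  · rintro _ ⟨i, rfl⟩
    rcases lt_or_ge i n with hi | hi
    · exact Submodule.subset_span ⟨⟨i, hi⟩, rfl⟩
    · simp [End.pow_map_zero_of_le hi hy]
  · rintro _ ⟨j, rfl⟩
    exact ⟨j, rfl⟩

theorem orbitKer_eq_ker_pi (hφ : φ ∘ₗ f ^ n = 0) :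
    orbitKer f φ = ker (LinearMap.pi fun i : Fin n => φ ∘ₗ f ^ (i : ℕ)) := by
  rw [ker_pi]
  refine le_antisymm (le_iInf fun i => iInf_le _ _) (le_iInf fun i => ?_)
  rcases lt_or_ge i n with hi | hi
  · exact iInf_le (fun j : Fin n => ker (φ ∘ₗ f ^ (j : ℕ))) ⟨i, hi⟩
  · have : φ ∘ₗ f ^ i = 0 := by
      rw [← Nat.add_sub_of_le hi, pow_add, End.mul_eq_comp, ← comp_assoc, hφ, zero_comp]
    simp [this]

end JordanChain

section Field

variable {K V : Type*} [Field K] [AddCommGroup V] [Module K V] {f : End K V} {y : V}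
  {φ : Dual K V} {n : ℕ}

theorem injective_pi_comp_linearCombination (hy : (f ^ (n + 1)) y = 0)
    (hφy : φ ((f ^ n) y) ≠ 0) :
    Function.Injective ((LinearMap.pi fun i : Fin (n + 1) => φ ∘ₗ f ^ (i : ℕ)) ∘ₗ
      Fintype.linearCombination K fun j : Fin (n + 1) => (f ^ (j : ℕ)) y) := by
  refine (injective_iff_map_eq_zero _).2 fun c hc => ?_
  have hankel (i : Fin (n + 1)) :
      ∑ j : Fin (n + 1), c j * φ ((f ^ (i + j : ℕ)) y) = 0 := by
    simpa [Fintype.linearCombination_apply, pow_add] using congrFun hc i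
  funext j
  induction j using WellFoundedLT.induction with | _ j ih
  have hrow := hankel j.rev
  rw [Finset.sum_eq_single j] at hrow
  · have : (j.rev + j : ℕ) = n := by rw [Fin.val_rev]; omega
    rw [this] at hrow
    exact (mul_eq_zero.1 hrow).resolve_right hφy
  · intro k _ hkj
    rcases lt_or_gt_of_ne hkj with hk | hk
    · simp [ih k hk]
    · have : n + 1 ≤ j.rev + k := by rw [Fin.val_rev]; omega
      rw [End.pow_map_zero_of_le this hy, map_zero, mul_zero]
  · simp

theorem isCompl_orbitKer_orbitSpan (hy : (f ^ (n + 1)) y = 0) (hφ : φ ∘ₗ f ^ (n + 1) = 0)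
    (hφy : φ ((f ^ n) y) ≠ 0) : IsCompl (orbitKer f φ) (orbitSpan f y) := by
  rw [orbitKer_eq_ker_pi hφ, orbitSpan_eq_range_linearCombination hy]
  have hinj := injective_pi_comp_linearCombination hy hφy
  exact isCompl_ker_range_of_bijective_comp ⟨hinj, injective_iff_surjective.1 hinj⟩

end Field

section NullityDeficiency

variable {R M N : Type*} [Ring R] [AddCommGroup M] [AddCommGroup N] [Module R M] [Module R N]
  {f : End R M} {g : End R N}

/-- The nullity of an endomorphism: the length of its kernel, which over a field is the dimension,
with all infinite dimensions identified. -/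
noncomputable def nullity (f : End R M) : ℕ∞ :=
  Module.length R (ker f)

/-- The deficiency of an endomorphism: the length of its cokernel, which over a field is the
codimension of the range, with all infinite codimensions identified. -/
noncomputable def deficiency (f : End R M) : ℕ∞ :=
  Module.length R (M ⧸ range f)

theorem nullity_prodMap (f : End R M) (g : End R N) :
    nullity (f.prodMap g) = nullity f + nullity g := by
  have hrange : range ((ker f).subtype.prodMap (ker g).subtype) = ker (f.prodMap g) := by
    rw [range_prodMap, Submodule.range_subtype, Submodule.range_subtype, ker_prodMap]
  have hinj : Function.Injective ((ker f).subtype.prodMap (ker g).subtype) :=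
    (ker f).subtype_injective.prodMap (ker g).subtype_injective
  rw [nullity, ← hrange, ← (LinearEquiv.ofInjective _ hinj).length_eq, Module.length_prod]
  rfl

theorem deficiency_prodMap (f : End R M) (g : End R N) :
    deficiency (f.prodMap g) = deficiency f + deficiency g := by
  have hker : ker ((range f).mkQ.prodMap (range g).mkQ) = range (f.prodMap g) := by
    rw [ker_prodMap, Submodule.ker_mkQ, Submodule.ker_mkQ, range_prodMap]
  have hsurj : Function.Surjective ((range f).mkQ.prodMap (range g).mkQ) :=
    (Submodule.mkQ_surjective _).prodMap (Submodule.mkQ_surjective _)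
  rw [deficiency, ← hker, (quotKerEquivOfSurjective _ hsurj).length_eq, Module.length_prod]
  rfl

theorem comap_ker_eq_of_semiconj (e : M ≃ₗ[R] N) (h : Function.Semiconj e f g) :
    (ker g).comap e.toLinearMap = ker f := by
  ext x
  simp [← h.eq]

theorem comap_range_eq_of_semiconj (e : M ≃ₗ[R] N) (h : Function.Semiconj e f g) :
    (range g).comap e.toLinearMap = range f := by
  ext x
  simp [e.surjective.exists, ← h.eq]

theorem nullity_eq_of_semiconj (e : M ≃ₗ[R] N) (h : Function.Semiconj e f g) :
    nullity f = nullity g := by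
  rw [nullity, ← comap_ker_eq_of_semiconj e h, (e.ofSubmodule' (ker g)).length_eq, nullity]

theorem deficiency_eq_of_semiconj (e : M ≃ₗ[R] N) (h : Function.Semiconj e f g) :
    deficiency f = deficiency g := by
  have hmap : (range f).map e.toLinearMap = range g := by
    rw [← comap_range_eq_of_semiconj e h, Submodule.map_comap_eq_of_surjective e.surjective]
  exact (Submodule.Quotient.equiv _ _ e hmap).length_eq

theorem nullity_pos_of_isNilpotent [Nontrivial M] (hf : IsNilpotent f) : 0 < nullity f := by
  obtain ⟨n, hn⟩ := hf
  rw [nullity, Module.length_pos_iff, Submodule.nontrivial_iff_ne_bot, Ne, ker_eq_bot]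
  intro hinj
  have : Function.Injective (0 : End R M) := by
    rw [← hn, End.coe_pow]
    exact hinj.iterate n
  obtain ⟨x, hx⟩ := exists_ne (0 : M)
  exact hx (this rfl)

theorem deficiency_pos_of_isNilpotent [Nontrivial M] (hf : IsNilpotent f) : 0 < deficiency f := by
  obtain ⟨n, hn⟩ := hf
  rw [deficiency, Module.length_pos_iff, Submodule.Quotient.nontrivial_iff, Ne, range_eq_top]
  intro hsurj
  have : Function.Surjective (0 : End R M) := by
    rw [← hn, End.coe_pow]
    exact hsurj.iterate n
  obtain ⟨x, hx⟩ := exists_ne (0 : M)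
  obtain ⟨y, hy⟩ := this x
  exact hx hy.symm

theorem min_nullity_deficiency_lt_prodMap [Nontrivial N] (hg : IsNilpotent g)
    (hf : min (nullity f) (deficiency f) ≠ ⊤) :
    min (nullity f) (deficiency f) <
      min (nullity (f.prodMap g)) (deficiency (f.prodMap g)) := by
  rw [nullity_prodMap, deficiency_prodMap]
  calc min (nullity f) (deficiency f) < min (nullity f) (deficiency f) + 1 :=
        (ENat.lt_add_one_iff hf).2 le_rfl
    _ = min (nullity f + 1) (deficiency f + 1) := (min_add_add_right ..).symm
    _ ≤ _ := by
      gcongr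
      · exact Order.one_le_iff_pos.2 (nullity_pos_of_isNilpotent hg)
      · exact Order.one_le_iff_pos.2 (deficiency_pos_of_isNilpotent hg)

end NullityDeficiency

section Field

variable {K V : Type*} [Field K] [AddCommGroup V] [Module K V]

theorem length_ne_top_iff_finiteDimensional : Module.length K V ≠ ⊤ ↔ FiniteDimensional K V := by
  rw [Module.length_ne_top_iff, isFiniteLength_iff_isNoetherian_isArtinian]
  exact ⟨fun ⟨_, _⟩ => inferInstance, fun _ => ⟨inferInstance, inferInstance⟩⟩

theorem cofg_range_mul {f g : End K V} (hf : (range f).CoFG) (hg : (range g).CoFG) :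
    (range (f * g)).CoFG := by
  obtain ⟨C, hC⟩ := Submodule.exists_isCompl (range g)
  obtain ⟨D, hD⟩ := Submodule.exists_isCompl (range f)
  refine Submodule.FG.cofg_of_codisjoint (S := C.map f ⊔ D) ?_
    (((Submodule.CoFG.fg_of_isCompl hC hg).map f).sup (Submodule.CoFG.fg_of_isCompl hD hf))
  rw [codisjoint_iff, End.mul_eq_comp, range_comp, sup_comm, ← sup_assoc, ← Submodule.map_sup,
    hC.sup_eq_top, Submodule.map_top, hD.sup_eq_top]

end Field

section Similarity

variable {𝕜 E F G H : Type*} [NontriviallyNormedField 𝕜]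
  [NormedAddCommGroup E] [NormedSpace 𝕜 E] [NormedAddCommGroup F] [NormedSpace 𝕜 F]
  [NormedAddCommGroup G] [NormedSpace 𝕜 G] [NormedAddCommGroup H] [NormedSpace 𝕜 H]

/-- Similarity of bounded operators on possibly different spaces. It lets an invariant direct sum
decomposition of `T` be written as `Similar (A.prodMap B) T`. -/
def Similar (S : E →L[𝕜] E) (T : F →L[𝕜] F) : Prop :=
  ∃ e : E ≃L[𝕜] F, Function.Semiconj e S T

variable {S : E →L[𝕜] E} {T : F →L[𝕜] F} {U : G →L[𝕜] G} {V : H →L[𝕜] H}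

namespace Similar

theorem refl (S : E →L[𝕜] E) : Similar S S :=
  ⟨.refl 𝕜 E, fun _ => rfl⟩

theorem symm : Similar S T → Similar T S := fun ⟨e, he⟩ =>
  ⟨e.symm, he.inverse_left e.symm_apply_apply e.apply_symm_apply⟩

theorem trans : Similar S T → Similar T U → Similar S U := fun ⟨e, he⟩ ⟨e', he'⟩ =>
  ⟨e.trans e', he'.comp_left he⟩

theorem prodMap : Similar S T → Similar U V → Similar (S.prodMap U) (T.prodMap V) :=
  fun ⟨e, he⟩ ⟨e', he'⟩ => ⟨e.prodCongr e', fun x => Prod.ext (he x.1) (he' x.2)⟩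

theorem prodAssoc (S : E →L[𝕜] E) (T : F →L[𝕜] F) (U : G →L[𝕜] G) :
    Similar ((S.prodMap T).prodMap U) (S.prodMap (T.prodMap U)) :=
  ⟨.prodAssoc 𝕜 E F G, fun _ => rfl⟩

theorem exists_algEquiv : Similar S T → ∃ φ : (E →L[𝕜] E) ≃ₐ[𝕜] (F →L[𝕜] F), φ S = T :=
  fun ⟨e, he⟩ => ⟨e.conjContinuousAlgEquiv.toAlgEquiv, by
    ext x
    simpa using he (e.symm x)⟩

theorem spectrum_eq (h : Similar S T) : spectrum 𝕜 S = spectrum 𝕜 T := by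
  obtain ⟨φ, rfl⟩ := h.exists_algEquiv
  exact (AlgEquiv.spectrum_eq φ S).symm

theorem isNilpotent (h : Similar S T) (hS : IsNilpotent S) : IsNilpotent T := by
  obtain ⟨φ, rfl⟩ := h.exists_algEquiv
  exact hS.map φ

theorem nullity_eq (h : Similar S T) : nullity S.toLinearMap = nullity T.toLinearMap :=
  let ⟨e, he⟩ := h
  nullity_eq_of_semiconj e.toLinearEquiv he

theorem deficiency_eq (h : Similar S T) : deficiency S.toLinearMap = deficiency T.toLinearMap :=
  let ⟨e, he⟩ := h
  deficiency_eq_of_semiconj e.toLinearEquiv he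

theorem isClosed_range (h : Similar S T) (hT : IsClosed (T.range : Set F)) :
    IsClosed (S.range : Set E) := by
  obtain ⟨e, he⟩ := h
  rw [← comap_range_eq_of_semiconj e.toLinearEquiv he]
  exact hT.preimage e.continuous

theorem ker_le_iInf_range_pow (h : Similar S T) (hT : T.ker ≤ ⨅ n : ℕ, (T ^ n).range) :
    S.ker ≤ ⨅ n : ℕ, (S ^ n).range := by
  obtain ⟨e, he⟩ := h
  refine le_iInf fun n => ?_
  have hpow : Function.Semiconj e ⇑(S ^ n) ⇑(T ^ n) := by
    simpa only [FunLike.coe_pow_eq_iterate] using he.iterate_right n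
  rw [← comap_ker_eq_of_semiconj e.toLinearEquiv he,
    ← comap_range_eq_of_semiconj e.toLinearEquiv hpow]
  exact Submodule.comap_mono (hT.trans (iInf_le _ n))

end Similar

theorem prodMap_pow (S : E →L[𝕜] E) (T : F →L[𝕜] F) (n : ℕ) :
    S.prodMap T ^ n = (S ^ n).prodMap (T ^ n) := by
  induction n with
  | zero => rfl
  | succ n ih => simp only [pow_succ, ih]; rfl

theorem isNilpotent_prodMap (hS : IsNilpotent S) (hT : IsNilpotent T) :
    IsNilpotent (S.prodMap T) := by
  obtain ⟨m, hm⟩ := hS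
  obtain ⟨n, hn⟩ := hT
  refine ⟨m + n, ?_⟩
  rw [prodMap_pow, pow_add, hm, zero_mul, pow_add, hn, mul_zero]
  rfl

theorem isClosed_range_of_isClosed_range_prodMap
    (h : IsClosed ((S.prodMap T).range : Set (E × F))) : IsClosed (S.range : Set E) := by
  convert h.preimage (Continuous.prodMk_left (0 : F)) using 1
  ext x
  simp

theorem spectrum_prodMap_subset [CompleteSpace E] [CompleteSpace F] :
    spectrum 𝕜 (S.prodMap T) ⊆ spectrum 𝕜 S ∪ spectrum 𝕜 T := by
  intro μ hμ
  contrapose! hμ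
  simp only [Set.mem_union, not_or, spectrum.notMem_iff,
    ContinuousLinearMap.isUnit_iff_bijective] at hμ ⊢
  exact hμ.1.prodMap hμ.2

theorem similar_restrict_range [CompleteSpace E] [CompleteSpace F] (i : E →L[𝕜] F)
    (hi : Function.Injective i) (hcl : IsClosed (Set.range i))
    (hiS : Function.Semiconj i S T) (hT : Set.MapsTo T i.range i.range) :
    Similar S (T.restrict hT) :=
  ⟨i.equivRange hi hcl, fun x => Subtype.ext (hiS x)⟩

end Similarity

section ClosedRange

variable {𝕜 E F : Type*} [NontriviallyNormedField 𝕜] [NormedAddCommGroup E] [NormedSpace 𝕜 E]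
  [NormedAddCommGroup F] [NormedSpace 𝕜 F] [CompleteSpace E] [CompleteSpace F] {T : E →L[𝕜] F}

theorem isClosed_map_of_isClosed_sup_ker (hT : IsClosed (T.range : Set F)) {G : Submodule 𝕜 E}
    (hG : IsClosed ((G ⊔ T.ker : Submodule 𝕜 E) : Set E)) :
    IsClosed (G.map T.toLinearMap : Set F) := by
  have : CompleteSpace T.range := hT.completeSpace_coe
  have hpre : T.rangeRestrict ⁻¹' (T.rangeRestrict '' G) = (G ⊔ T.ker : Submodule 𝕜 E) := by
    rw [← LinearMap.ker_rangeRestrict, ← Submodule.comap_map_eq]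
    rfl
  have himage : IsClosed (T.rangeRestrict '' G) := by
    rwa [← (T.rangeRestrict.isQuotientMap T.surjective_rangeRestrict).isClosed_preimage,
      hpre]
  have := hT.isClosedEmbedding_subtypeVal.isClosedMap _ himage
  rwa [Set.image_image] at this

theorem isClosed_range_of_finiteDimensional_quotient [CompleteSpace 𝕜]
    [FiniteDimensional 𝕜 (F ⧸ T.range)] : IsClosed (T.range : Set F) := by
  obtain ⟨C, hC⟩ := Submodule.exists_isCompl T.range
  have : FiniteDimensional 𝕜 C := .equiv (Submodule.quotientEquivOfIsCompl _ _ hC)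
  let S := T.ker.liftQL T le_rfl
  have : IsClosed (T.ker : Set E) := T.isClosed_ker
  have hrange : S.range = T.range := Submodule.range_liftQ _ _ _
  have hker : S.ker = ⊥ := Submodule.ker_liftQ_eq_bot _ _ _ le_rfl
  rw [← hrange]
  exact S.closed_complemented_range_of_isCompl_of_ker_eq_bot C (hrange ▸ hC)
    C.closed_of_finiteDimensional hker

end ClosedRange

section SemiFredholm

variable {Y Z : Type*} [NormedAddCommGroup Y] [NormedSpace ℂ Y] [NormedAddCommGroup Z]
  [NormedSpace ℂ Z] {S : Y →L[ℂ] Y} {T : Z →L[ℂ] Z}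

theorem Similar.isSemiRegular (h : Similar S T) (hT : IsSemiRegular T) : IsSemiRegular S :=
  ⟨h.isClosed_range hT.1, h.ker_le_iInf_range_pow hT.2⟩

theorem isQuasiNilpotent_of_isNilpotent (hS : IsNilpotent S) : IsQuasiNilpotent S := by
  obtain ⟨n, hn⟩ := hS
  intro μ hμ
  rcases subsingleton_or_nontrivial Y with _ | _
  · simp [spectrum.of_subsingleton] at hμ
  have hpow : μ ^ n ∈ spectrum ℂ (S ^ n) := spectrum.pow_mem_pow S n hμ
  rw [hn, spectrum.zero_eq] at hpow
  exact eq_zero_of_pow_eq_zero hpow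

theorem IsUpperSemiFredholm.isClosed_range_pow [CompleteSpace Y] (hS : IsUpperSemiFredholm S)
    (n : ℕ) : IsClosed ((S ^ n).range : Set Y) := by
  have : FiniteDimensional ℂ S.ker := hS.2
  induction n with
  | zero => simp [End.one_eq_id]
  | succ n ih =>
    rw [pow_succ', ContinuousLinearMap.mul_def, ContinuousLinearMap.toLinearMap_comp, range_comp]
    exact isClosed_map_of_isClosed_sup_ker hS.1 (Submodule.isClosed_sup_finiteDimensional _ _ ih)

theorem IsLowerSemiFredholm.pow (hS : IsLowerSemiFredholm S) (n : ℕ) :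
    IsLowerSemiFredholm (S ^ n) := by
  induction n with
  | zero =>
    rw [IsLowerSemiFredholm, pow_zero, range_eq_top.2 Function.surjective_id]
    infer_instance
  | succ n ih => exact cofg_range_mul ih hS

theorem IsLowerSemiFredholm.isClosed_range [CompleteSpace Y] (hS : IsLowerSemiFredholm S) :
    IsClosed (S.range : Set Y) :=
  have : FiniteDimensional ℂ (Y ⧸ S.range) := hS
  isClosed_range_of_finiteDimensional_quotient

variable [CompleteSpace Y]

theorem IsSemiFredholm.isClosed_range_pow (hS : IsSemiFredholm S) (n : ℕ) :
    IsClosed ((S ^ n).range : Set Y) :=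
  hS.elim (·.isClosed_range_pow n) (·.pow n |>.isClosed_range)

theorem isSemiFredholm_iff : IsSemiFredholm S ↔ IsClosed (S.range : Set Y) ∧
    min (nullity S.toLinearMap) (deficiency S.toLinearMap) ≠ ⊤ := by
  have hlower : IsLowerSemiFredholm S ↔ IsClosed (S.range : Set Y) ∧ IsLowerSemiFredholm S :=
    ⟨fun h => ⟨h.isClosed_range, h⟩, And.right⟩
  rw [IsSemiFredholm, hlower, IsUpperSemiFredholm, ← and_or_left, Ne, min_eq_top, not_and_or,
    nullity, deficiency, ← Ne, ← Ne, length_ne_top_iff_finiteDimensional,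
    length_ne_top_iff_finiteDimensional, IsLowerSemiFredholm]

theorem Similar.isSemiFredholm [CompleteSpace Z] (h : Similar S T) (hT : IsSemiFredholm T) :
    IsSemiFredholm S := by
  rw [isSemiFredholm_iff] at hT ⊢
  exact ⟨h.isClosed_range hT.1, by rw [h.nullity_eq, h.deficiency_eq]; exact hT.2⟩

theorem IsSemiFredholm.of_prodMap [CompleteSpace Z] (h : IsSemiFredholm (S.prodMap T)) :
    IsSemiFredholm S := by
  rw [isSemiFredholm_iff] at h ⊢
  refine ⟨isClosed_range_of_isClosed_range_prodMap h.1, ne_top_of_le_ne_top h.2 ?_⟩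
  rw [ContinuousLinearMap.coe_prodMap, nullity_prodMap, deficiency_prodMap]
  exact min_le_min le_self_add le_self_add

end SemiFredholm

section Splitting

theorem exists_strongDual_eq_zero_on_of_notMem {𝕜 E : Type*} [RCLike 𝕜] [NormedAddCommGroup E]
    [NormedSpace 𝕜 E] {p : Submodule 𝕜 E} (hp : IsClosed (p : Set E)) {x : E} (hx : x ∉ p) :
    ∃ φ : StrongDual 𝕜 E, (∀ z ∈ p, φ z = 0) ∧ φ x ≠ 0 := by
  have hx' : p.mkQ x ≠ 0 := by simpa using hx
  obtain ⟨g, hg⟩ := SeparatingDual.exists_ne_zero (R := 𝕜) hx'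
  refine ⟨g.comp p.mkQL, fun z hz => ?_, hg⟩
  have hz' : p.mkQ z = 0 := by simpa using hz
  exact (congrArg g hz').trans g.map_zero

variable {𝕜 E : Type*} [NontriviallyNormedField 𝕜] [NormedAddCommGroup E] [NormedSpace 𝕜 E]

theorem isClosed_orbitKer (S : E →L[𝕜] E) (φ : StrongDual 𝕜 E) :
    IsClosed (orbitKer S.toLinearMap φ.toLinearMap : Set E) := by
  simp only [orbitKer, Submodule.coe_iInf]
  refine isClosed_iInter fun i => ?_
  rw [← ContinuousLinearMap.toLinearMap_pow]
  exact (φ.comp (S ^ i)).isClosed_ker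

theorem isNilpotent_restrict {S : E →L[𝕜] E} {N : Submodule 𝕜 E} (hN : Set.MapsTo S N N) {n : ℕ}
    (h : ∀ z ∈ N, (S.toLinearMap ^ n) z = 0) : IsNilpotent (S.restrict hN) := by
  refine ⟨n, ContinuousLinearMap.ext fun z => Subtype.ext ?_⟩
  have hval : Function.Semiconj N.subtype (S.restrict hN) S.toLinearMap := fun _ => rfl
  rw [FunLike.coe_pow_eq_iterate]
  refine (hval.iterate_right n z).trans ?_
  rw [← End.coe_pow]
  exact h z z.2

variable {Y : Type*} [NormedAddCommGroup Y] [NormedSpace ℂ Y] {S : Y →L[ℂ] Y}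

theorem reduces_orbitKer_orbitSpan {φ : StrongDual ℂ Y} {y : Y} {n : ℕ}
    (hy : (S.toLinearMap ^ (n + 1)) y = 0)
    (hφ : φ.toLinearMap ∘ₗ S.toLinearMap ^ (n + 1) = 0) (hφy : φ ((S.toLinearMap ^ n) y) ≠ 0) :
    Reduces S (orbitKer S.toLinearMap φ.toLinearMap) (orbitSpan S.toLinearMap y) where
  isClosed_left := isClosed_orbitKer S φ
  isClosed_right := by
    rw [orbitSpan_eq_range_linearCombination hy]
    exact Submodule.closed_of_finiteDimensional _
  mapsTo_left := mapsTo_orbitKer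
  mapsTo_right := mapsTo_orbitSpan
  isCompl := isCompl_orbitKer_orbitSpan hy hφ hφy

theorem exists_reduces_isNilpotent_of_not_ker_le (hcl : ∀ n, IsClosed ((S ^ n).range : Set Y))
    (hS : ¬ S.ker ≤ ⨅ n : ℕ, (S ^ n).range) :
    ∃ (M N : Submodule ℂ Y) (h : Reduces S M N),
      Nontrivial N ∧ IsNilpotent (S.restrict h.mapsTo_right) := by
  simp only [ContinuousLinearMap.toLinearMap_pow] at hcl hS
  obtain ⟨n, y, hy, hny⟩ := exists_pow_succ_apply_eq_zero_of_not_ker_le hS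
  obtain ⟨φ, hφ, hφy⟩ := exists_strongDual_eq_zero_on_of_notMem (hcl (n + 1)) hny
  have hred := reduces_orbitKer_orbitSpan hy (LinearMap.ext fun z => hφ _ ⟨z, rfl⟩) hφy
  have hy0 : y ≠ 0 := by
    rintro rfl
    simp at hφy
  exact ⟨_, _, hred, ⟨⟨y, mem_orbitSpan_self⟩, 0, by simpa using hy0⟩,
    isNilpotent_restrict _ fun z => pow_apply_eq_zero_of_mem_orbitSpan hy⟩

end Splitting

section Reduction

variable {Y : Type*} [NormedAddCommGroup Y] [NormedSpace ℂ Y]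

theorem reduces_top_bot (T : Y →L[ℂ] Y) : Reduces T ⊤ ⊥ where
  isClosed_left := isClosed_univ
  isClosed_right := isClosed_singleton
  mapsTo_left := Set.mapsTo_univ _ _
  mapsTo_right := by simp [Set.MapsTo]
  isCompl := isCompl_top_bot

variable [CompleteSpace Y] {T : Y →L[ℂ] Y} {M N : Submodule ℂ Y}

theorem Reduces.similar_prodMap (h : Reduces T M N) :
    Similar ((T.restrict h.mapsTo_left).prodMap (T.restrict h.mapsTo_right)) T :=
  ⟨Submodule.prodEquivOfIsTopCompl M N
    (Submodule.isTopCompl_iff_isCompl_isClosed.2 ⟨h.isCompl, h.isClosed_left, h.isClosed_right⟩),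
    fun x => (map_add T (x.1 : Y) x.2).symm⟩

variable {E F : Type*} [NormedAddCommGroup E] [NormedSpace ℂ E] [CompleteSpace E]
  [NormedAddCommGroup F] [NormedSpace ℂ F] [CompleteSpace F] {A : E →L[ℂ] E} {B : F →L[ℂ] F}

theorem Similar.exists_reduces (h : Similar (A.prodMap B) T) :
    ∃ (M N : Submodule ℂ Y) (h : Reduces T M N),
      Similar A (T.restrict h.mapsTo_left) ∧ Similar B (T.restrict h.mapsTo_right) := by
  obtain ⟨e, he⟩ := h
  let i : E →L[ℂ] Y := e.toContinuousLinearMap.comp (.inl ℂ E F)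
  let j : F →L[ℂ] Y := e.toContinuousLinearMap.comp (.inr ℂ E F)
  have hi : Function.LeftInverse (fun y => (e.symm y).1) i := fun x => by simp [i]
  have hj : Function.LeftInverse (fun y => (e.symm y).2) j := fun x => by simp [j]
  have hicl : IsClosed (Set.range i) := hi.isClosed_range (by fun_prop) i.continuous
  have hjcl : IsClosed (Set.range j) := hj.isClosed_range (by fun_prop) j.continuous
  have hiT : Function.Semiconj i A T := fun x => by simp [i, ← he.eq]
  have hjT : Function.Semiconj j B T := fun x => by simp [j, ← he.eq]
  have hred : Reduces T i.range j.range :=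
    { isClosed_left := hicl
      isClosed_right := hjcl
      mapsTo_left := by rintro _ ⟨x, rfl⟩; exact ⟨A x, hiT x⟩
      mapsTo_right := by rintro _ ⟨x, rfl⟩; exact ⟨B x, hjT x⟩
      isCompl := by
        rw [ContinuousLinearMap.toLinearMap_comp, ContinuousLinearMap.toLinearMap_comp, range_comp,
          range_comp]
        exact (isCompl_range_inl_inr (R := ℂ) (M := E) (M₂ := F)).map
          (Submodule.orderIsoMapComap e.toLinearEquiv) }
  exact ⟨_, _, hred, similar_restrict_range i hi.injective hicl hiT _,
    similar_restrict_range j hj.injective hjcl hjT _⟩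

theorem Reduces.exists_refine (h : Reduces T M N) {P L : Submodule ℂ M}
    (h' : Reduces (T.restrict h.mapsTo_left) P L) :
    ∃ (M' N' : Submodule ℂ Y) (h'' : Reduces T M' N'),
      Similar ((T.restrict h.mapsTo_left).restrict h'.mapsTo_left)
          (T.restrict h''.mapsTo_left) ∧
        Similar (((T.restrict h.mapsTo_left).restrict h'.mapsTo_right).prodMap
          (T.restrict h.mapsTo_right)) (T.restrict h''.mapsTo_right) := by
  have := h.isClosed_left.completeSpace_coe
  have := h.isClosed_right.completeSpace_coe
  have := h'.isClosed_left.completeSpace_coe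
  have := h'.isClosed_right.completeSpace_coe
  exact (((Similar.prodAssoc _ _ _).symm.trans (h'.similar_prodMap.prodMap (.refl _))).trans
    h.similar_prodMap).exists_reduces

theorem IsSemiFredholm.restrict_left (hT : IsSemiFredholm T) (h : Reduces T M N) :
    IsSemiFredholm (T.restrict h.mapsTo_left) := by
  have := h.isClosed_left.completeSpace_coe
  have := h.isClosed_right.completeSpace_coe
  exact .of_prodMap (h.similar_prodMap.isSemiFredholm hT)

theorem Reduces.min_nullity_deficiency_restrict_lt (h : Reduces T M N) (hT : IsSemiFredholm T)
    [Nontrivial N] (hN : IsNilpotent (T.restrict h.mapsTo_right)) :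
    min (nullity (T.restrict h.mapsTo_left).toLinearMap)
        (deficiency (T.restrict h.mapsTo_left).toLinearMap) <
      min (nullity T.toLinearMap) (deficiency T.toLinearMap) := by
  have := h.isClosed_left.completeSpace_coe
  rw [← h.similar_prodMap.nullity_eq, ← h.similar_prodMap.deficiency_eq]
  exact min_nullity_deficiency_lt_prodMap (hN.map ContinuousLinearMap.toLinearMapRingHom)
    (isSemiFredholm_iff.1 (hT.restrict_left h)).2

end Reduction

section KatoDecomposition

theorem IsSemiFredholm.exists_reduces_isSemiRegular {Y : Type*} [NormedAddCommGroup Y]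
    [NormedSpace ℂ Y] [CompleteSpace Y] {S : Y →L[ℂ] Y} (hS : IsSemiFredholm S) :
    ∃ (M N : Submodule ℂ Y) (h : Reduces S M N),
      IsSemiRegular (S.restrict h.mapsTo_left) ∧ IsNilpotent (S.restrict h.mapsTo_right) := by
  generalize hd : min (nullity S.toLinearMap) (deficiency S.toLinearMap) = d
  induction d using WellFoundedLT.induction generalizing Y with | _ d ih
  by_cases hker : S.ker ≤ ⨅ n : ℕ, (S ^ n).range
  · have hreg : IsSemiRegular S := ⟨(isSemiFredholm_iff.1 hS).1, hker⟩
    have htop : Similar (S.restrict (reduces_top_bot S).mapsTo_left) S :=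
      ⟨Submodule.topContEquiv, fun _ => rfl⟩
    exact ⟨⊤, ⊥, reduces_top_bot S, htop.isSemiRegular hreg, 1, Subsingleton.elim _ _⟩
  obtain ⟨P, L, h, _, hL⟩ :=
    exists_reduces_isNilpotent_of_not_ker_le hS.isClosed_range_pow hker
  have : CompleteSpace P := h.isClosed_left.completeSpace_coe
  obtain ⟨M, N, h', hM, hN⟩ :=
    ih _ (hd ▸ h.min_nullity_deficiency_restrict_lt hS hL) (hS.restrict_left h) rfl
  obtain ⟨M', N', h'', hM', hN'⟩ := h.exists_refine h'
  exact ⟨M', N', h'', hM'.symm.isSemiRegular hM, hN'.isNilpotent (isNilpotent_prodMap hN hL)⟩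

theorem isPseudoSemiBFredholm_iff {Y : Type*} [NormedAddCommGroup Y] [NormedSpace ℂ Y]
    {T : Y →L[ℂ] Y} :
    IsPseudoSemiBFredholm T ↔ ∃ (M N : Submodule ℂ Y) (h : Reduces T M N),
      IsSemiFredholm (T.restrict h.mapsTo_left) ∧ IsQuasiNilpotent (T.restrict h.mapsTo_right) := by
  simp only [IsPseudoSemiBFredholm, IsUpperPseudoSemiBFredholm, IsLowerPseudoSemiBFredholm,
    IsSemiFredholm, or_and_right, exists_or]

theorem IsPseudoSemiBFredholm.exists_reduces_isSemiRegular {Y : Type*} [NormedAddCommGroup Y]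
    [NormedSpace ℂ Y] [CompleteSpace Y] {T : Y →L[ℂ] Y} (hT : IsPseudoSemiBFredholm T) :
    ∃ (M N : Submodule ℂ Y) (h : Reduces T M N),
      (IsSemiFredholm (T.restrict h.mapsTo_left) ∧ IsSemiRegular (T.restrict h.mapsTo_left)) ∧
        IsQuasiNilpotent (T.restrict h.mapsTo_right) := by
  obtain ⟨M₀, N₀, h₀, hM₀, hN₀⟩ := isPseudoSemiBFredholm_iff.1 hT
  have := h₀.isClosed_left.completeSpace_coe
  have := h₀.isClosed_right.completeSpace_coe
  obtain ⟨P, L, hPL, hP, hL⟩ := hM₀.exists_reduces_isSemiRegular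
  have := hPL.isClosed_left.completeSpace_coe
  have := hPL.isClosed_right.completeSpace_coe
  obtain ⟨M, N, h, hM, hN⟩ := h₀.exists_refine hPL
  have := h.isClosed_left.completeSpace_coe
  refine ⟨M, N, h, ⟨hM.symm.isSemiFredholm (hM₀.restrict_left hPL), hM.symm.isSemiRegular hP⟩, ?_⟩
  rw [IsQuasiNilpotent, ← hN.spectrum_eq]
  exact spectrum_prodMap_subset.trans
    (Set.union_subset (isQuasiNilpotent_of_isNilpotent hL) hN₀)

end KatoDecomposition

end PseudoFredholm

theorem mainTheorem8 {X : Type*} [NormedAddCommGroup X] [NormedSpace ℂ X] [CompleteSpace X]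
    (T : X →L[ℂ] X) :
    (PseudoFredholm.IsPseudoSemiBFredholm T ↔
      ∃ (M N : Submodule ℂ X) (h : PseudoFredholm.Reduces T M N),
        (PseudoFredholm.IsSemiFredholm (T.restrict h.mapsTo_left) ∧
          PseudoFredholm.IsSemiRegular (T.restrict h.mapsTo_left)) ∧
        PseudoFredholm.IsQuasiNilpotent (T.restrict h.mapsTo_right)) ∧
    (PseudoFredholm.IsPseudoSemiBFredholm T → PseudoFredholm.IsPseudoFredholm T) := by
  have hKato (hT : PseudoFredholm.IsPseudoSemiBFredholm T) := hT.exists_reduces_isSemiRegular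
  refine ⟨⟨hKato, fun ⟨M, N, h, hM, hN⟩ => ?_⟩, fun hT => ?_⟩
  · exact PseudoFredholm.isPseudoSemiBFredholm_iff.2 ⟨M, N, h, hM.1, hN⟩
  · obtain ⟨M, N, h, hM, hN⟩ := hKato hT
    exact ⟨M, N, h, hM.2, hN⟩
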